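/- Let $\mathscr X$ be a Banach space, let $L:D(L)\subset\mathscr X\to\mathscr X$ be the generator of a strongly continuous semigroup on $\mathscr X$, let $N:\mathscr X\to\mathscr X$, and put $f(v)=Lv+N(v)$ for $v\in D(L)$. Let $t_0<T$ and let $u\in C^4([t_0,T];\mathscr X)$ be a solution of $u'(t)=f(u(t))$, $u(t_0)=u_0$, with $u(t)\in D(L)$ for all $t\in[t_0,T]$. Assume that $N$ is three times continuously Fréchet differentiable in a strip $\{v:\operatorname{dist}(v,u([t_0,T]))<\delta\}$, $\delta>0$. For $t_n\in[t_0,T]$ write $\tilde u_n=u(t_n)$, $\tilde u_n^{(j)}=u^{(j)}(t_n)$, $\tilde J_n=L+\frac{\partial N}{\partial u}(\tilde u_n)$ (with domain $D(L)$) and $\tilde N_n(v)=N(v)-\frac{\partial N}{\partial u}(\tilde u_n)v$. Then $\tilde J_n$ generates a strongly continuous semigroup $(e^{\tau\tilde J_n})_{\tau\ge0}$, and for $k\ge1$, $\tau\ge0$ we set $$\varphi_k(\tau\tilde J_n)x=\int_0^1 \frac{\theta^{k-1}}{(k-1)!}\,e^{(1-\theta)\tau\tilde J_n}x\,d\theta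 .$$ (i) For every $k\ge1$ and all $t\ge0$, $h\ge0$, $$\varphi_k(th\tilde J_n)f(\tilde u_n)=\frac1{k!}\tilde u_n'+h\frac{t}{(k+1)!}\tilde u_n''+t^2h^2\frac1{(k+2)!}\Big(\tilde u_n^{(3)}-(k+2)!\,\varphi_{k+2}(th\tilde J_n)\frac{\partial^2\tilde N_n}{\partial u^2}(\tilde u_n)(\tilde u_n',\tilde u_n')\Big)+\mathcal O(t^3h^3).$$ (ii) Let $s\in\mathbb N$, $p_{i1k}\in\mathbb R$ for $1\le k\le s$, and $\psi_{i1}(z)=\sum_{k=1}^s p_{i1k}\varphi_k(z)$. Then for all $t\ge0$ $$\psi_{i1}(t\tilde J_n)f(\tilde u_n)=\mathbb P_{i1}\tilde u_n'+t\,\mathbb P_{i2}\tilde u_n''+t^2\Big(\mathbb P_{i3}\tilde u_n^{(3)}-\sum_{k=1}^s p_{i1k}\varphi_{k+2}(t\tilde J_n)\frac{\partial^2\tilde N_n}{\partial u^2}(\tilde u_n)(\tilde u_n',\tilde u_n')\Big)+\mathcal O(t^3),$$ where $\mathbb P_{i1}=\sum_{k=1}^s\frac{p_{i1k}}{k!}$,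 $\mathbb P_{i2}=\sum_{k=1}^s\frac{p_{i1k}}{(k+1)!}$, $\mathbb P_{i3}=\sum_{k=1}^s\frac{p_{i1k}}{(k+2)!}$. Here the $\mathcal O$-terms are uniform on bounded ranges: for every $H$ there is a constant $C$, independent of $t_n\in[t_0,T]$, $t$ and $h$, such that the norm of the remainder in (i) is at most $Ct^3h^3$ whenever $th\le H$ (with $C$ depending on $k$), and the norm of the remainder in (ii) is at most $Ct^3$ whenever $t\le H$ (with $C$ depending on $s$ and the $p_{i1k}$). -/

import Mathlib

open Set Filter Topology MeasureTheory

namespace EPIRK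

variable {X : Type*} [NormedAddCommGroup X] [NormedSpace ℝ X]

/-- A strongly continuous one-parameter semigroup of bounded operators `S t`, `t ≥ 0`
(the values at negative times are irrelevant). -/
structure IsC0Semigroup (S : ℝ → X →L[ℝ] X) : Prop where
  map_zero : S 0 = ContinuousLinearMap.id ℝ X
  map_add : ∀ s t : ℝ, 0 ≤ s → 0 ≤ t → S (s + t) = (S s).comp (S t)
  continuousOn : ∀ x : X, ContinuousOn (fun t => S t x) (Ici 0)

/-- The (possibly unbounded) operator `A` is the infinitesimal generator of `S`: `x ∈ D(A)` and
`A x = y` if and only if `(S t x - x) / t → y` as `t ↓ 0`. -/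
def IsGeneratorOf (A : X →ₗ.[ℝ] X) (S : ℝ → X →L[ℝ] X) : Prop :=
  ∀ x y : X, (x, y) ∈ A.graph ↔
    Tendsto (fun t : ℝ => t⁻¹ • (S t x - x)) (𝓝[>] 0) (𝓝 y)

/-- `A` is the generator of a strongly continuous semigroup. -/
def GeneratesC0Semigroup (A : X →ₗ.[ℝ] X) : Prop :=
  ∃ S : ℝ → X →L[ℝ] X, IsC0Semigroup S ∧ IsGeneratorOf A S

open Classical in
/-- The semigroup `e^{tA}`, `t ≥ 0`, generated by `A`; its values for `t ≥ 0` are determined by `A`.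
(It is the zero family if `A` generates no strongly continuous semigroup.) -/
noncomputable def expSemigroup (A : X →ₗ.[ℝ] X) : ℝ → X →L[ℝ] X :=
  if h : GeneratesC0Semigroup A then h.choose else 0

/-- `φ_k(τ A) x = ∫₀¹ θ^{k-1}/(k-1)! • e^{(1-θ) τ A} x dθ`, for `k ≥ 1` and `τ ≥ 0`. -/
noncomputable def phi (k : ℕ) (τ : ℝ) (A : X →ₗ.[ℝ] X) (x : X) : X :=
  ∫ θ in (0 : ℝ)..1, (θ ^ (k - 1) / ((k - 1).factorial : ℝ)) • expSemigroup A ((1 - θ) * τ) x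

/-- `ψ(τ A) x = ∑_{k=1}^s p_k φ_k(τ A) x`. -/
noncomputable def psi (s : ℕ) (p : ℕ → ℝ) (τ : ℝ) (A : X →ₗ.[ℝ] X) (x : X) : X :=
  ∑ k ∈ Finset.Icc 1 s, p k • phi k τ A x

/-- `ℙ₁ = ∑_{k=1}^s p_k / k!`. -/
noncomputable def bigP1 (s : ℕ) (p : ℕ → ℝ) : ℝ :=
  ∑ k ∈ Finset.Icc 1 s, p k / (k.factorial : ℝ)

/-- `ℙ₂ = ∑_{k=1}^s p_k / (k+1)!`. -/
noncomputable def bigP2 (s : ℕ) (p : ℕ → ℝ) : ℝ :=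
  ∑ k ∈ Finset.Icc 1 s, p k / ((k + 1).factorial : ℝ)

/-- `ℙ₃ = ∑_{k=1}^s p_k / (k+2)!`. -/
noncomputable def bigP3 (s : ℕ) (p : ℕ → ℝ) : ℝ :=
  ∑ k ∈ Finset.Icc 1 s, p k / ((k + 2).factorial : ℝ)

/-- The right-hand side `f(v) = L v + N(v)`, defined for `v ∈ D(L)`. -/
def rhs (L : X →ₗ.[ℝ] X) (N : X → X) (v : L.domain) : X :=
  L v + N v

/-- The Jacobian `J(w) = L + N'(w)`, with domain `D(L)`. -/
noncomputable def jacobian (L : X →ₗ.[ℝ] X) (N : X → X) (w : X) : X →ₗ.[ℝ] X :=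
  (fderiv ℝ N w : X →ₗ[ℝ] X) +ᵥ L

/-- The nonlinearity `Ñ(v) = N(v) - N'(w) v` left after linearization at `w`. -/
noncomputable def remNonlin (N : X → X) (w v : X) : X :=
  N v - fderiv ℝ N w v

/-- On `D(L)` one has `Ñ(v) = f(v) - J(w) v`. -/
theorem remNonlin_eq (L : X →ₗ.[ℝ] X) (N : X → X) (w : X) (v : L.domain) :
    remNonlin N w v = rhs L N v - jacobian L N w v := by
  have h : jacobian L N w v = fderiv ℝ N w v + L v := rfl
  rw [h, rhs, remNonlin]
  abel

/-- `u : [t₀, T] → X` is a four times continuously differentiable solution of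
`u' = L u + N(u)`, `u(t₀) = u₀`, and `N` is three times continuously Fréchet differentiable in a
strip of some radius `δ > 0` around the trajectory of `u`. -/
structure SmoothSolution (L : X →ₗ.[ℝ] X) (N : X → X) (t₀ T : ℝ) (u₀ : X) (u : ℝ → X) :
    Prop where
  lt : t₀ < T
  init : u t₀ = u₀
  mem_domain : ∀ t ∈ Icc t₀ T, u t ∈ L.domain
  hasDeriv : ∀ t (ht : t ∈ Icc t₀ T),
    HasDerivWithinAt u (rhs L N ⟨u t, mem_domain t ht⟩) (Icc t₀ T) t
  contDiffOn : ContDiffOn ℝ 4 u (Icc t₀ T)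
  nonlin : ∃ δ > 0, ContDiffOn ℝ 3 N (Metric.thickening δ (u '' Icc t₀ T))

/-- The second Fréchet derivative term `Ñ''(u(τ))(u'(τ), u'(τ))`, with `Ñ` the nonlinearity left
after linearization at `u(τ)`; the derivative of `u` is taken within `[t₀, T]`. -/
noncomputable def secondTerm (N : X → X) (t₀ T : ℝ) (u : ℝ → X) (τ : ℝ) : X :=
  iteratedFDeriv ℝ 2 (remNonlin N (u τ)) (u τ)
    (fun _ => iteratedDerivWithin 1 u (Icc t₀ T) τ)

end EPIRK

/-!
Fix `tₙ`, put `J = L + N'(u(tₙ))` and `Ñ(v) = N(v) - N'(u(tₙ)) v`, so that `u' = J u + Ñ(u)` along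
the whole trajectory. As `J` is closed, this equation can be differentiated three times. At `tₙ` the
derivative of `Ñ` vanishes, which leaves `J u' = u''`, `J u'' = u''' - Ñ''(u)(u', u')` and a vector
`J u'''` that is bounded uniformly in `tₙ`. Three applications of the recursion
`φ_k(τJ) x = x / k! + τ φ_{k+1}(τJ) J x` to `x = u'(tₙ) = f(u(tₙ))` give the expansion, with
remainder `τ³ φ_{k+3}(τJ) J u'''`.

The constants are uniform in `tₙ` because a bounded perturbation `L + B` of a generator generates a
semigroup `V`, the solution of the Duhamel equation `V t = S t + ∫₀ᵗ S (t - s) B V s ds`, and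
Grönwall's inequality turns `‖S t‖ ≤ M e^{ωt}` into `‖V t‖ ≤ M e^{(ω + M‖B‖)t}`; along the compact
trajectory the norms `‖N'(u(tₙ))‖` are bounded.
-/

namespace EPIRK

section Calculus

variable {E : Type*} [NormedAddCommGroup E] [NormedSpace ℝ E]

theorem hasDerivWithinAt_Ici_iff_tendsto_inv_smul {g : ℝ → E} {y : E} {s : ℝ} :
    HasDerivWithinAt g y (Ici s) s ↔
      Tendsto (fun t : ℝ => t⁻¹ • (g (s + t) - g s)) (𝓝[>] 0) (𝓝 y) := by
  have hmap : map (s + ·) (𝓝[>] 0) = 𝓝[>] s := by simp [map_add_left_nhdsGT]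
  rw [← hasDerivWithinAt_Ioi_iff_Ici, hasDerivWithinAt_iff_tendsto_slope' (by simp), ← hmap,
    tendsto_map'_iff]
  refine tendsto_congr fun t => ?_
  simp [slope_def_module]

theorem hasDerivWithinAt_Ici_iff_comp_const_add {g : ℝ → E} {y : E} {s : ℝ} :
    HasDerivWithinAt g y (Ici s) s ↔ HasDerivWithinAt (fun t => g (s + t)) y (Ici 0) 0 := by
  simp [hasDerivWithinAt_Ici_iff_tendsto_inv_smul]

theorem hasDerivWithinAt_integral_Ici [CompleteSpace E] {f : ℝ → E} {a t : ℝ}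
    (hf : ContinuousOn f (Ici a)) (ht : a ≤ t) :
    HasDerivWithinAt (fun r => ∫ s in a..r, f s) (f t) (Ici a) t := by
  have hc : Continuous fun s => f (max a s) :=
    hf.comp_continuous (by fun_prop) fun s => le_max_left a s
  have h := (hc.integral_hasStrictDerivAt a t).hasDerivAt.hasDerivWithinAt (s := Ici a)
  rw [max_eq_right ht] at h
  refine h.congr_of_mem (fun r hr => intervalIntegral.integral_congr fun s hs => ?_) ht
  rw [uIcc_of_le hr] at hs
  simp only [max_eq_right hs.1]

theorem hasDerivAt_integral_diagonal [CompleteSpace E] {F : ℝ → ℝ → E}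
    (hF : Continuous (Function.uncurry F)) :
    HasDerivAt (fun t => ∫ s in (0 : ℝ)..t, F t s) (F 0 0) 0 := by
  have hc : Continuous fun t : ℝ => ∫ θ in (0 : ℝ)..1, F t (t * θ) :=
    intervalIntegral.continuous_parametric_intervalIntegral_of_continuous'
      (f := fun t θ => F t (t * θ))
      (hF.comp (continuous_fst.prodMk (continuous_fst.mul continuous_snd))) 0 1
  have hscale (t : ℝ) : ∫ s in (0 : ℝ)..t, F t s = t • ∫ θ in (0 : ℝ)..1, F t (t * θ) := by
    simp
  rw [hasDerivAt_iff_tendsto_slope_zero]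
  have h0 : Tendsto (fun t : ℝ => ∫ θ in (0 : ℝ)..1, F t (t * θ)) (𝓝[≠] 0) (𝓝 (F 0 0)) := by
    simpa using (hc.tendsto 0).mono_left nhdsWithin_le_nhds
  refine h0.congr' ?_
  filter_upwards [self_mem_nhdsWithin] with t ht
  rw [zero_add, hscale t, intervalIntegral.integral_same, sub_zero, inv_smul_smul₀ ht]

theorem le_mul_exp_of_le_add_mul_integral {d : ℝ → ℝ} {a b K : ℝ} (hK : 0 ≤ K)
    (hd : ContinuousOn d (Ici b)) (h : ∀ t, b ≤ t → d t ≤ a + K * ∫ s in b..t, d s)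
    {t : ℝ} (ht : b ≤ t) : d t ≤ a * Real.exp (K * (t - b)) := by
  set D : ℝ → ℝ := fun t => a + K * ∫ s in b..t, d s with hD
  have hderiv (r : ℝ) (hr : b ≤ r) : HasDerivWithinAt D (K * d r) (Ici b) r :=
    ((hasDerivWithinAt_integral_Ici hd hr).const_mul K).const_add a
  have hbound := le_gronwallBound_of_liminf_deriv_right_le (f := D) (δ := a) (K := K) (ε := 0)
    (fun r hr => ((hderiv r hr.1).continuousWithinAt).mono Icc_subset_Ici_self)
    (fun r hr q hq => by
      simpa [slope_def_field, div_eq_inv_mul] using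
        ((hderiv r hr.1).mono (Ici_subset_Ici.2 hr.1)).liminf_right_slope_le hq)
    (by simp [hD]) (fun r hr => by simpa using mul_le_mul_of_nonneg_left (h r hr.1) hK)
    t ⟨ht, le_rfl⟩
  rw [gronwallBound_ε0] at hbound
  exact (h t ht).trans hbound

theorem iteratedDerivWithin_prodMk {F : Type*} [NormedAddCommGroup F] [NormedSpace ℝ F]
    {v : ℝ → E} {w : ℝ → F} {I : Set ℝ} {n : ℕ} {t : ℝ} (hv : ContDiffWithinAt ℝ n v I t)
    (hw : ContDiffWithinAt ℝ n w I t) (hI : UniqueDiffOn ℝ I) (ht : t ∈ I) :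
    iteratedDerivWithin n (fun r => (v r, w r)) I t =
      (iteratedDerivWithin n v I t, iteratedDerivWithin n w I t) := by
  simp [iteratedDerivWithin, iteratedFDerivWithin_prodMk hv hw hI ht le_rfl]

theorem derivWithin_mem_of_isClosed {p : Submodule ℝ E} (hp : IsClosed (p : Set E)) {v : ℝ → E}
    {I : Set ℝ} (hv : ∀ r ∈ I, v r ∈ p) (t : ℝ) : derivWithin v I t ∈ p := by
  have h := range_derivWithin_subset_closure_span_image v (s := I) (t := I)
    (by rw [inter_self]; exact subset_closure)
  refine closure_minimal (Submodule.span_le.2 ?_) hp (h (mem_range_self t))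
  rintro _ ⟨r, hr, rfl⟩
  exact hv r hr

theorem iteratedDerivWithin_mem_of_isClosed {p : Submodule ℝ E} (hp : IsClosed (p : Set E))
    {v : ℝ → E} {I : Set ℝ} (hv : ∀ r ∈ I, v r ∈ p) (n : ℕ) {t : ℝ} (ht : t ∈ I) :
    iteratedDerivWithin n v I t ∈ p := by
  induction n generalizing t with
  | zero => simpa using hv t ht
  | succ n ih =>
    rw [iteratedDerivWithin_succ]
    exact derivWithin_mem_of_isClosed hp (fun r hr => ih hr) t

theorem iteratedDerivWithin_mem_graph {F : Type*} [NormedAddCommGroup F] [NormedSpace ℝ F]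
    {A : E →ₗ.[ℝ] F} (hA : IsClosed (A.graph : Set (E × F))) {v : ℝ → E} {w : ℝ → F} {I : Set ℝ}
    {n : ℕ} {t : ℝ} (hv : ContDiffWithinAt ℝ n v I t) (hw : ContDiffWithinAt ℝ n w I t)
    (hI : UniqueDiffOn ℝ I) (ht : t ∈ I) (h : ∀ r ∈ I, (v r, w r) ∈ A.graph) :
    (iteratedDerivWithin n v I t, iteratedDerivWithin n w I t) ∈ A.graph := by
  rw [← iteratedDerivWithin_prodMk hv hw hI ht]
  exact iteratedDerivWithin_mem_of_isClosed hA h n ht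

end Calculus

section Semigroup

variable {X : Type*} [NormedAddCommGroup X] [NormedSpace ℝ X] {A : X →ₗ.[ℝ] X}
  {S : ℝ → X →L[ℝ] X} {M M' ω ω' : ℝ}

/-- The family `S` has type `(M, ω)`: `‖S t‖ ≤ M e^{ωt}` for all `t ≥ 0`. -/
def HasGrowthBound (S : ℝ → X →L[ℝ] X) (M ω : ℝ) : Prop :=
  ∀ t, 0 ≤ t → ‖S t‖ ≤ M * Real.exp (ω * t)

namespace HasGrowthBound

theorem nonneg (hS : HasGrowthBound S M ω) : 0 ≤ M := by
  simpa using (norm_nonneg _).trans (hS 0 le_rfl)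

theorem mono_right (hS : HasGrowthBound S M ω) (h : ω ≤ ω') : HasGrowthBound S M ω' := by
  intro t ht
  have := hS.nonneg
  exact (hS t ht).trans (by gcongr)

theorem exp_smul (hS : HasGrowthBound S M ω) (c : ℝ) :
    HasGrowthBound (fun t => Real.exp (c * t) • S t) M (c + ω) := by
  intro t ht
  rw [norm_smul, Real.norm_of_nonneg (Real.exp_pos _).le]
  calc Real.exp (c * t) * ‖S t‖ ≤ Real.exp (c * t) * (M * Real.exp (ω * t)) := by
        gcongr
        exact hS t ht
    _ = M * Real.exp ((c + ω) * t) := by rw [add_mul, Real.exp_add]; ring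

theorem norm_apply_le (hS : HasGrowthBound S M ω) {t : ℝ} (ht : 0 ≤ t) (x : X) :
    ‖S t x‖ ≤ M * Real.exp (ω * t) * ‖x‖ :=
  (S t).le_of_opNorm_le (hS t ht) x

end HasGrowthBound

namespace IsC0Semigroup

theorem map_add_apply (hS : IsC0Semigroup S) {s t : ℝ} (hs : 0 ≤ s) (ht : 0 ≤ t) (x : X) :
    S (s + t) x = S s (S t x) := by
  simp [hS.map_add s t hs ht]

theorem map_nat_mul (hS : IsC0Semigroup S) {t : ℝ} (ht : 0 ≤ t) (n : ℕ) : S (n * t) = S t ^ n := by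
  induction n with
  | zero => simp [hS.map_zero, ContinuousLinearMap.one_def]
  | succ n ih =>
    rw [Nat.cast_succ, add_one_mul, hS.map_add _ _ (by positivity) ht, ih, pow_succ]
    rfl

theorem exp_smul (hS : IsC0Semigroup S) (c : ℝ) :
    IsC0Semigroup fun t => Real.exp (c * t) • S t where
  map_zero := by simp [hS.map_zero]
  map_add s t hs ht := by
    ext x
    simp [hS.map_add_apply hs ht, mul_add, Real.exp_add, smul_smul, mul_comm]
  continuousOn x := by
    have : ContinuousOn (fun t : ℝ => Real.exp (c * t)) (Ici 0) := by fun_prop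
    exact this.smul (hS.continuousOn x)

variable [CompleteSpace X]

theorem exists_hasGrowthBound (hS : IsC0Semigroup S) : ∃ M ω, 0 ≤ ω ∧ HasGrowthBound S M ω := by
  obtain ⟨C, hC⟩ := banach_steinhaus (g := fun t : Icc (0 : ℝ) 1 => S t) fun x => by
    obtain ⟨C, hC⟩ := isCompact_Icc.exists_bound_of_continuousOn
      ((hS.continuousOn x).mono (Icc_subset_Ici_self : Icc (0 : ℝ) 1 ⊆ Ici 0))
    exact ⟨C, fun t => hC t t.2⟩
  obtain ⟨M, hM1, hM⟩ : ∃ M, 1 ≤ M ∧ ∀ t ∈ Icc (0 : ℝ) 1, ‖S t‖ ≤ M :=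
    ⟨max C 1, le_max_right _ _, fun t ht => (hC ⟨t, ht⟩).trans (le_max_left _ _)⟩
  have hω : 0 ≤ Real.log M := Real.log_nonneg hM1
  refine ⟨M, Real.log M, hω, fun t ht => ?_⟩
  set n := ⌊t⌋₊
  have hn : t ≤ (n + 1 : ℕ) := by exact_mod_cast (Nat.lt_floor_add_one t).le
  calc ‖S t‖ = ‖S (t / (n + 1 : ℕ)) ^ (n + 1)‖ := by
        rw [← hS.map_nat_mul (by positivity), mul_div_cancel₀]
        positivity
    _ ≤ ‖S (t / (n + 1 : ℕ))‖ ^ (n + 1) := norm_pow_le' _ n.succ_pos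
    _ ≤ M ^ (n + 1) := by
        gcongr
        exact hM _ ⟨by positivity, div_le_one_of_le₀ hn (by positivity)⟩
    _ = M * Real.exp (Real.log M * n) := by
        rw [mul_comm (Real.log M), Real.exp_nat_mul, Real.exp_log (by positivity), pow_succ']
    _ ≤ M * Real.exp (Real.log M * t) := by
        gcongr
        exact Nat.floor_le ht

theorem continuousOn_uncurry (hS : IsC0Semigroup S) :
    ContinuousOn (fun p : ℝ × X => S p.1 p.2) (Ici 0 ×ˢ univ) := by
  obtain ⟨M, ω, -, hM⟩ := hS.exists_hasGrowthBound
  rintro ⟨t, x⟩ ⟨ht, -⟩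
  have hpoint : ContinuousWithinAt (fun p : ℝ × X => S p.1 x) (Ici 0 ×ˢ univ) (t, x) :=
    ContinuousWithinAt.comp (f := Prod.fst) (x := (t, x)) (hS.continuousOn x t ht)
      continuousWithinAt_fst fun p hp => hp.1
  have hdiff : Tendsto (fun p : ℝ × X => S p.1 (p.2 - x)) (𝓝[Ici 0 ×ˢ univ] (t, x)) (𝓝 0) := by
    refine squeeze_zero_norm' (a := fun p => M * Real.exp (ω * p.1) * ‖p.2 - x‖) ?_ ?_
    · filter_upwards [self_mem_nhdsWithin] with p hp
      exact hM.norm_apply_le hp.1 _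
    · have hc : Continuous fun p : ℝ × X => M * Real.exp (ω * p.1) * ‖p.2 - x‖ := by fun_prop
      simpa using (hc.tendsto (t, x)).mono_left nhdsWithin_le_nhds
  simpa [ContinuousWithinAt] using hdiff.add hpoint

theorem continuousOn_apply (hS : IsC0Semigroup S) {Y : Type*} [TopologicalSpace Y] {s : Set Y}
    {a : Y → ℝ} {w : Y → X} (ha : ContinuousOn a s) (hw : ContinuousOn w s)
    (h0 : ∀ y ∈ s, 0 ≤ a y) : ContinuousOn (fun y => S (a y) (w y)) s :=
  hS.continuousOn_uncurry.comp (ha.prodMk hw) fun y hy => ⟨h0 y hy, mem_univ _⟩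

end IsC0Semigroup

namespace IsGeneratorOf

theorem mem_graph_iff_hasDerivWithinAt (hA : IsGeneratorOf A S) (hS : IsC0Semigroup S) {x y : X} :
    (x, y) ∈ A.graph ↔ HasDerivWithinAt (fun t => S t x) y (Ici 0) 0 := by
  simp [hasDerivWithinAt_Ici_iff_tendsto_inv_smul, hA x y, hS.map_zero]

theorem hasDerivWithinAt_orbit_right (hA : IsGeneratorOf A S) (hS : IsC0Semigroup S) {x y : X}
    (h : (x, y) ∈ A.graph) {s : ℝ} (hs : 0 ≤ s) :
    HasDerivWithinAt (fun t => S t x) (S s y) (Ici s) s := by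
  rw [hasDerivWithinAt_Ici_iff_comp_const_add]
  refine ((S s).hasFDerivAt.comp_hasDerivWithinAt 0
    ((hA.mem_graph_iff_hasDerivWithinAt hS).1 h)).congr_of_mem (fun t ht => ?_) self_mem_Ici
  exact hS.map_add_apply hs ht x

theorem map_mem_graph (hA : IsGeneratorOf A S) (hS : IsC0Semigroup S) {x y : X}
    (h : (x, y) ∈ A.graph) {s : ℝ} (hs : 0 ≤ s) : (S s x, S s y) ∈ A.graph := by
  rw [hA.mem_graph_iff_hasDerivWithinAt hS]
  refine (hasDerivWithinAt_Ici_iff_comp_const_add.1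
    (hA.hasDerivWithinAt_orbit_right hS h hs)).congr_of_mem (fun t ht => ?_) self_mem_Ici
  rw [add_comm, hS.map_add_apply ht hs]

variable [CompleteSpace X]

theorem sub_eq_integral (hA : IsGeneratorOf A S) (hS : IsC0Semigroup S) {x y : X}
    (h : (x, y) ∈ A.graph) {t : ℝ} (ht : 0 ≤ t) : S t x - x = ∫ s in (0 : ℝ)..t, S s y := by
  have hIcc : Icc 0 t ⊆ Ici 0 := Icc_subset_Ici_self
  rw [intervalIntegral.integral_eq_sub_of_hasDeriv_right_of_le ht
    ((hS.continuousOn x).mono hIcc)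
    (fun s hs => (hA.hasDerivWithinAt_orbit_right hS h hs.1.le).mono Ioi_subset_Ici_self)
    (((hS.continuousOn y).mono hIcc).intervalIntegrable_of_Icc ht)]
  simp [hS.map_zero]

theorem hasDerivWithinAt_orbit (hA : IsGeneratorOf A S) (hS : IsC0Semigroup S) {x y : X}
    (h : (x, y) ∈ A.graph) {s : ℝ} (hs : 0 ≤ s) :
    HasDerivWithinAt (fun t => S t x) (S s y) (Ici 0) s := by
  refine ((hasDerivWithinAt_integral_Ici (hS.continuousOn y) hs).const_add x).congr_of_mem
    (fun t ht => ?_) hs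
  rw [← hA.sub_eq_integral hS h ht, add_sub_cancel]

theorem mem_graph_iff_forall_sub_eq_integral (hA : IsGeneratorOf A S) (hS : IsC0Semigroup S)
    {x y : X} : (x, y) ∈ A.graph ↔ ∀ t, 0 ≤ t → S t x - x = ∫ s in (0 : ℝ)..t, S s y := by
  refine ⟨fun h t ht => hA.sub_eq_integral hS h ht, fun h => ?_⟩
  have hy := (hasDerivWithinAt_integral_Ici (hS.continuousOn y) le_rfl).const_add x
  rw [hS.map_zero] at hy
  rw [hA.mem_graph_iff_hasDerivWithinAt hS]
  refine hy.congr_of_mem (fun t ht => ?_) self_mem_Ici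
  rw [← h t ht, add_sub_cancel]

theorem isClosed_graph (hA : IsGeneratorOf A S) (hS : IsC0Semigroup S) :
    IsClosed (A.graph : Set (X × X)) := by
  have hset : (A.graph : Set (X × X)) =
      ⋂ t ∈ Ici (0 : ℝ), {p | S t p.1 - p.1 = ∫ s in (0 : ℝ)..t, S s p.2} := by
    ext ⟨x, y⟩
    simp [hA.mem_graph_iff_forall_sub_eq_integral hS]
  rw [hset]
  refine isClosed_biInter fun t ht => isClosed_eq (by fun_prop) ?_
  have hmax (p : X × X) : ∫ s in (0 : ℝ)..t, S s p.2 = ∫ s in (0 : ℝ)..t, S (max 0 s) p.2 := by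
    refine intervalIntegral.integral_congr fun s hs => ?_
    rw [uIcc_of_le ht] at hs
    simp only [max_eq_right hs.1]
  simp only [hmax]
  refine intervalIntegral.continuous_parametric_intervalIntegral_of_continuous' ?_ 0 t
  exact continuousOn_univ.1
    (hS.continuousOn_apply (by fun_prop) (by fun_prop) fun q _ => le_max_left _ _)

theorem integral_mem_graph (hA : IsGeneratorOf A S) (hS : IsC0Semigroup S) (x : X) {ε : ℝ}
    (hε : 0 ≤ ε) : (∫ s in (0 : ℝ)..ε, S s x, S ε x - x) ∈ A.graph := by
  set F : ℝ → X := fun t => ∫ s in (0 : ℝ)..t, S s x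
  have hint {a b : ℝ} (ha : 0 ≤ a) (hb : 0 ≤ b) :
      IntervalIntegrable (fun s => S s x) volume a b :=
    ((hS.continuousOn x).mono fun s hs => (le_min ha hb).trans hs.1).intervalIntegrable
  have hshift (t : ℝ) (ht : 0 ≤ t) : S t (F ε) = F (ε + t) - F t := by
    rw [intervalIntegral.integral_interval_sub_left (hint le_rfl (by positivity)) (hint le_rfl ht),
      ← ContinuousLinearMap.intervalIntegral_comp_comm _ (hint le_rfl hε)]
    have hcomp := intervalIntegral.integral_comp_add_left (a := 0) (b := ε) (fun s => S s x) t
    rw [add_zero, add_comm t ε] at hcomp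
    rw [← hcomp]
    refine intervalIntegral.integral_congr fun s hs => ?_
    rw [uIcc_of_le hε] at hs
    exact (hS.map_add_apply ht hs.1 x).symm
  have hF {t : ℝ} (ht : 0 ≤ t) : HasDerivWithinAt F (S t x) (Ici t) t :=
    (hasDerivWithinAt_integral_Ici (hS.continuousOn x) ht).mono (Ici_subset_Ici.2 ht)
  have h := (hasDerivWithinAt_Ici_iff_comp_const_add.1 (hF hε)).sub (hF le_rfl)
  rw [hS.map_zero] at h
  exact (hA.mem_graph_iff_hasDerivWithinAt hS).2 (h.congr_of_mem hshift self_mem_Ici)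

theorem dense_domain (hA : IsGeneratorOf A S) (hS : IsC0Semigroup S) :
    Dense (A.domain : Set X) := by
  intro x
  have h := hasDerivWithinAt_Ici_iff_tendsto_inv_smul.1
    (hasDerivWithinAt_integral_Ici (hS.continuousOn x) le_rfl)
  simp only [hS.map_zero, zero_add, intervalIntegral.integral_same, sub_zero] at h
  refine mem_closure_of_tendsto h ?_
  filter_upwards [self_mem_nhdsWithin] with t ht
  exact A.domain.smul_mem _
    (LinearPMap.mem_domain_of_mem_graph (hA.integral_mem_graph hS x (le_of_lt ht)))

end IsGeneratorOf

theorem GeneratesC0Semigroup.isClosed_graph [CompleteSpace X] (hA : GeneratesC0Semigroup A) :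
    IsClosed (A.graph : Set (X × X)) :=
  let ⟨_, hS, hAS⟩ := hA
  hAS.isClosed_graph hS

end Semigroup

section MildSolution

variable {X : Type*} [NormedAddCommGroup X] [NormedSpace ℝ X] {S : ℝ → X →L[ℝ] X} {M ω μ : ℝ}
  {B : X →L[ℝ] X} {v w : ℝ → X} {x y : X}

/-- The convolution `(S ∗ w)(t) = ∫₀ᵗ S(t - s) w(s) ds` of a semigroup with a forcing term `w`. -/
noncomputable def conv (S : ℝ → X →L[ℝ] X) (w : ℝ → X) (t : ℝ) : X :=
  ∫ s in (0 : ℝ)..t, S (t - s) (w s)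

/-- `v` is a mild solution of the perturbed Cauchy problem `v' = (A + B) v`, `v(0) = x`, where `A`
generates `S`: it solves the Duhamel equation `v(t) = S(t) x + ∫₀ᵗ S(t - s) B v(s) ds`, `t ≥ 0`. -/
structure IsMildSolution (S : ℝ → X →L[ℝ] X) (B : X →L[ℝ] X) (x : X) (v : ℝ → X) : Prop where
  continuousOn : ContinuousOn v (Ici 0)
  eq_add_conv : ∀ t, 0 ≤ t → v t = S t x + conv S (fun s => B (v s)) t

theorem conv_const_smul (c t : ℝ) : conv S (fun s => c • w s) t = c • conv S w t := by
  simp [conv]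

theorem conv_exp_smul (c t : ℝ) :
    conv (fun s => Real.exp (c * s) • S s) (fun s => Real.exp (c * s) • w s) t =
      Real.exp (c * t) • conv S w t := by
  rw [conv, conv, ← intervalIntegral.integral_smul]
  refine intervalIntegral.integral_congr fun s _ => ?_
  simp only [smul_apply, map_smul, smul_smul, ← Real.exp_add]
  congr 2
  ring

theorem conv_congr {t : ℝ} (ht : 0 ≤ t) (h : EqOn v w (Ici 0)) : conv S v t = conv S w t := by
  refine intervalIntegral.integral_congr fun s hs => ?_
  rw [uIcc_of_le ht] at hs
  simp only [h hs.1]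

theorem conv_eq_integral_max {t : ℝ} (ht : 0 ≤ t) :
    conv S w t = ∫ s in (0 : ℝ)..t, S (max 0 (t - s)) (w (max 0 s)) := by
  refine intervalIntegral.integral_congr fun s hs => ?_
  rw [uIcc_of_le ht] at hs
  simp only [max_eq_right hs.1, max_eq_right (sub_nonneg.2 hs.2)]

theorem integral_exp_neg_mul_sub_le (hμ : 0 < μ) (t : ℝ) :
    ∫ s in (0 : ℝ)..t, Real.exp (-μ * (t - s)) ≤ μ⁻¹ := by
  have h : ∫ s in (0 : ℝ)..t, Real.exp (-μ * (t - s)) = μ⁻¹ * (1 - Real.exp (-μ * t)) := by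
    rw [intervalIntegral.integral_comp_sub_left (fun s => Real.exp (-μ * s)),
      intervalIntegral.integral_comp_mul_left Real.exp (neg_ne_zero.2 hμ.ne'), integral_exp]
    simp only [sub_self, sub_zero, mul_zero, Real.exp_zero, smul_eq_mul, inv_neg]
    ring
  rw [h]
  exact mul_le_of_le_one_right (by positivity) (by linarith [Real.exp_pos (-μ * t)])

theorem HasGrowthBound.norm_conv_le_of_norm_le (hS : HasGrowthBound S M (-μ)) (hμ : 0 < μ)
    {C : ℝ} (hw : ∀ s, 0 ≤ s → ‖w s‖ ≤ C) {t : ℝ} (ht : 0 ≤ t) : ‖conv S w t‖ ≤ M * C / μ := by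
  have hC : 0 ≤ C := (norm_nonneg _).trans (hw 0 le_rfl)
  have hM := hS.nonneg
  calc ‖conv S w t‖ ≤ ∫ s in (0 : ℝ)..t, M * C * Real.exp (-μ * (t - s)) := by
        refine intervalIntegral.norm_integral_le_of_norm_le ht (ae_of_all _ fun s hs => ?_)
          (Continuous.intervalIntegrable (by fun_prop) _ _)
        calc ‖S (t - s) (w s)‖ ≤ M * Real.exp (-μ * (t - s)) * C :=
              (hS.norm_apply_le (sub_nonneg.2 hs.2) _).trans (by gcongr; exact hw s hs.1.le)
          _ = M * C * Real.exp (-μ * (t - s)) := by ring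
    _ ≤ M * C * μ⁻¹ := by
        rw [intervalIntegral.integral_const_mul]
        gcongr
        exact integral_exp_neg_mul_sub_le hμ t
    _ = M * C / μ := (div_eq_mul_inv _ _).symm

theorem IsMildSolution.const_smul (hv : IsMildSolution S B x v) (c : ℝ) :
    IsMildSolution S B (c • x) (fun t => c • v t) where
  continuousOn := hv.continuousOn.const_smul c
  eq_add_conv t ht := by simp only [map_smul, conv_const_smul, hv.eq_add_conv t ht, smul_add]

theorem IsMildSolution.congr (hv : IsMildSolution S B x v) (h : EqOn w v (Ici 0)) :
    IsMildSolution S B x w where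
  continuousOn := hv.continuousOn.congr h
  eq_add_conv t ht := by
    rw [h ht, hv.eq_add_conv t ht]
    congr 1
    exact conv_congr ht fun s hs => by simp only [h hs]

theorem IsMildSolution.exp_smul (hv : IsMildSolution S B x v) (c : ℝ) :
    IsMildSolution (fun t => Real.exp (c * t) • S t) B x (fun t => Real.exp (c * t) • v t) where
  continuousOn := ContinuousOn.smul (by fun_prop) hv.continuousOn
  eq_add_conv t ht := by
    simp only [map_smul, conv_exp_smul, hv.eq_add_conv t ht, smul_add, smul_apply]

theorem IsMildSolution.continuousOn_perturbation (hv : IsMildSolution S B x v) :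
    ContinuousOn (fun t => B (v t)) (Ici 0) :=
  B.continuous.comp_continuousOn hv.continuousOn

theorem IsMildSolution.apply_zero (hv : IsMildSolution S B x v) (hS : IsC0Semigroup S) :
    v 0 = x := by
  simp [hv.eq_add_conv 0 le_rfl, conv, hS.map_zero]

theorem IsMildSolution.norm_le_of_bounded (hv : IsMildSolution S B x v)
    (hM : ∀ t, 0 ≤ t → ‖S t‖ ≤ M) {t : ℝ}
    (ht : 0 ≤ t) : ‖v t‖ ≤ M * ‖x‖ * Real.exp (M * ‖B‖ * t) := by
  have hM0 : 0 ≤ M := (norm_nonneg _).trans (hM 0 le_rfl)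
  have hint (r : ℝ) (hr : 0 ≤ r) : ‖v r‖ ≤ M * ‖x‖ + M * ‖B‖ * ∫ s in (0 : ℝ)..r, ‖v s‖ := by
    have hconv : ‖conv S (fun s => B (v s)) r‖ ≤ ∫ s in (0 : ℝ)..r, M * ‖B‖ * ‖v s‖ := by
      refine intervalIntegral.norm_integral_le_of_norm_le hr (ae_of_all _ fun s hs => ?_)
        (((hv.continuousOn.norm.mono Icc_subset_Ici_self).intervalIntegrable_of_Icc hr).const_mul _)
      rw [mul_assoc]
      exact (S _).le_of_opNorm_le_of_le (hM _ (sub_nonneg.2 hs.2)) (B.le_opNorm _)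
    rw [hv.eq_add_conv r hr, ← intervalIntegral.integral_const_mul]
    exact norm_add_le_of_le ((S r).le_of_opNorm_le (hM r hr) x) hconv
  simpa using le_mul_exp_of_le_add_mul_integral (by positivity) hv.continuousOn.norm hint ht

theorem IsMildSolution.norm_le (hv : IsMildSolution S B x v) (hM : HasGrowthBound S M ω) {t : ℝ}
    (ht : 0 ≤ t) :
    ‖v t‖ ≤ M * Real.exp ((ω + M * ‖B‖) * t) * ‖x‖ := by
  have h := (hv.exp_smul (-ω)).norm_le_of_bounded
    (fun s hs => by simpa using hM.exp_smul (-ω) s hs) ht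
  rw [norm_smul, Real.norm_of_nonneg (Real.exp_pos _).le, neg_mul, Real.exp_neg,
    inv_mul_le_iff₀ (Real.exp_pos _)] at h
  calc ‖v t‖ ≤ Real.exp (ω * t) * (M * ‖x‖ * Real.exp (M * ‖B‖ * t)) := h
    _ = M * Real.exp ((ω + M * ‖B‖) * t) * ‖x‖ := by
        rw [add_mul, Real.exp_add]
        ring

variable [CompleteSpace X]

namespace IsC0Semigroup

theorem intervalIntegrable_conv (hS : IsC0Semigroup S) (hw : ContinuousOn w (Ici 0)) {t a b : ℝ}
    (ha : 0 ≤ a) (hab : a ≤ b) (hbt : b ≤ t) :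
    IntervalIntegrable (fun s => S (t - s) (w s)) volume a b :=
  (hS.continuousOn_apply (by fun_prop) (hw.mono fun _ hs => ha.trans hs.1)
    fun _ hs => sub_nonneg.2 (hs.2.trans hbt)).intervalIntegrable_of_Icc hab

theorem conv_add (hS : IsC0Semigroup S) (hv : ContinuousOn v (Ici 0)) (hw : ContinuousOn w (Ici 0))
    {t : ℝ} (ht : 0 ≤ t) : conv S (fun s => v s + w s) t = conv S v t + conv S w t := by
  simp only [conv, (S _).map_add]
  exact intervalIntegral.integral_add (hS.intervalIntegrable_conv hv le_rfl ht le_rfl)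
    (hS.intervalIntegrable_conv hw le_rfl ht le_rfl)

theorem conv_add_time (hS : IsC0Semigroup S) (hw : ContinuousOn w (Ici 0)) {t a : ℝ}
    (ht : 0 ≤ t) (ha : 0 ≤ a) :
    conv S w (t + a) = S t (conv S w a) + conv S (fun s => w (s + a)) t := by
  have hta : a ≤ t + a := le_add_of_nonneg_left ht
  rw [conv, ← intervalIntegral.integral_add_adjacent_intervals
    (hS.intervalIntegrable_conv hw le_rfl ha hta) (hS.intervalIntegrable_conv hw ha hta le_rfl)]
  congr 1
  · rw [conv, ← ContinuousLinearMap.intervalIntegral_comp_comm _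
      (hS.intervalIntegrable_conv hw le_rfl ha le_rfl)]
    refine intervalIntegral.integral_congr fun s hs => ?_
    rw [uIcc_of_le ha] at hs
    simp only [← hS.map_add_apply ht (sub_nonneg.2 hs.2), add_sub_assoc]
  · simpa [conv, add_sub_add_right_eq_sub] using
      (intervalIntegral.integral_comp_add_right (a := 0) (b := t)
        (fun s => S (t + a - s) (w s)) a).symm

theorem continuous_conv_kernel (hS : IsC0Semigroup S) (hw : ContinuousOn w (Ici 0)) :
    Continuous (Function.uncurry fun t s : ℝ => S (max 0 (t - s)) (w (max 0 s))) := by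
  refine continuousOn_univ.1 (hS.continuousOn_apply (by fun_prop) ?_ fun _ _ => le_max_left _ _)
  exact hw.comp (by fun_prop) fun _ _ => mem_Ici.2 (le_max_left _ _)

theorem continuousOn_conv (hS : IsC0Semigroup S) (hw : ContinuousOn w (Ici 0)) :
    ContinuousOn (conv S w) (Ici 0) :=
  (intervalIntegral.continuous_parametric_intervalIntegral_of_continuous
    (hS.continuous_conv_kernel hw) continuous_id).continuousOn.congr
      fun _ ht => conv_eq_integral_max ht

theorem hasDerivWithinAt_conv_zero (hS : IsC0Semigroup S) (hw : ContinuousOn w (Ici 0)) :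
    HasDerivWithinAt (conv S w) (w 0) (Ici 0) 0 := by
  have h := (hasDerivAt_integral_diagonal (hS.continuous_conv_kernel hw)).hasDerivWithinAt
    (s := Ici 0)
  simp only [sub_self, max_self, hS.map_zero, ContinuousLinearMap.id_apply] at h
  exact h.congr_of_mem (fun _ ht => conv_eq_integral_max ht) self_mem_Ici

end IsC0Semigroup

namespace IsMildSolution

theorem add (hv : IsMildSolution S B x v) (hw : IsMildSolution S B y w) (hS : IsC0Semigroup S) :
    IsMildSolution S B (x + y) (fun t => v t + w t) where
  continuousOn := hv.continuousOn.add hw.continuousOn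
  eq_add_conv t ht := by
    simp only [map_add]
    rw [hS.conv_add hv.continuousOn_perturbation hw.continuousOn_perturbation ht,
      hv.eq_add_conv t ht, hw.eq_add_conv t ht]
    abel

theorem comp_add_right (hv : IsMildSolution S B x v) (hS : IsC0Semigroup S) {a : ℝ} (ha : 0 ≤ a) :
    IsMildSolution S B (v a) (fun t => v (t + a)) where
  continuousOn := hv.continuousOn.comp (by fun_prop) fun _ ht => add_nonneg ht ha
  eq_add_conv t ht := by
    rw [hv.eq_add_conv _ (add_nonneg ht ha), hS.map_add_apply ht ha,
      hS.conv_add_time hv.continuousOn_perturbation ht ha,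
      hv.eq_add_conv a ha, map_add, add_assoc]

theorem eqOn (hv : IsMildSolution S B x v) (hw : IsMildSolution S B x w) (hS : IsC0Semigroup S) :
    EqOn v w (Ici 0) := by
  obtain ⟨M, ω, -, hM⟩ := hS.exists_hasGrowthBound
  intro t ht
  have h := (hv.add (hw.const_smul (-1)) hS).norm_le hM ht
  rw [neg_one_smul, neg_one_smul, add_neg_cancel, norm_zero, mul_zero, norm_le_zero_iff] at h
  exact add_neg_eq_zero.1 h

end IsMildSolution

open scoped BoundedContinuousFunction NNReal

theorem IsC0Semigroup.exists_boundedContinuousFunction_duhamel (hS : IsC0Semigroup S)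
    (hM : HasGrowthBound S M (-μ)) (hμ : 0 < μ) (B : X →L[ℝ] X) (x : X) (v : ℝ≥0 →ᵇ X) :
    ∃ w : ℝ≥0 →ᵇ X, ∀ t : ℝ≥0, w t = S t x + conv S (fun s => B (v s.toNNReal)) t := by
  have hM0 := hM.nonneg
  have hv : Continuous fun s : ℝ => B (v s.toNNReal) :=
    B.continuous.comp (v.continuous.comp continuous_real_toNNReal)
  have hcont : ContinuousOn (fun t => S t x + conv S (fun s => B (v s.toNNReal)) t) (Ici 0) :=
    (hS.continuousOn x).add (hS.continuousOn_conv hv.continuousOn)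
  refine ⟨.ofNormedAddCommGroup (fun t : ℝ≥0 => S t x + conv S (fun s => B (v s.toNNReal)) t)
    (hcont.comp_continuous NNReal.continuous_coe fun t => t.2)
    (M * ‖x‖ + M * (‖B‖ * ‖v‖) / μ) fun t => ?_, fun t => rfl⟩
  refine norm_add_le_of_le ?_
    (hM.norm_conv_le_of_norm_le hμ (fun s _ => B.le_opNorm_of_le (v.norm_coe_le_norm _)) t.2)
  refine (hM.norm_apply_le t.2 x).trans ?_
  have hexp : Real.exp (-μ * t) ≤ 1 := Real.exp_le_one_iff.2 (by simpa using by positivity)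
  gcongr
  exact mul_le_of_le_one_right hM0 hexp

theorem IsC0Semigroup.exists_isMildSolution_of_stable (hS : IsC0Semigroup S)
    (hM : HasGrowthBound S M (-μ)) (hμ : 0 < μ) (hB : M * ‖B‖ / μ ≤ 1 / 2) (x : X) :
    ∃ v, IsMildSolution S B x v := by
  choose Φ hΦ using hS.exists_boundedContinuousFunction_duhamel hM hμ B x
  have hBc (v : ℝ≥0 →ᵇ X) : Continuous fun s : ℝ => B (v s.toNNReal) :=
    B.continuous.comp (v.continuous.comp continuous_real_toNNReal)
  have hcontr : ContractingWith (1 / 2) Φ := by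
    refine ⟨by norm_num, LipschitzWith.of_dist_le_mul fun v w => ?_⟩
    refine (BoundedContinuousFunction.dist_le (by positivity)).2 fun t => ?_
    have hdiff : Φ v t - Φ w t = conv S (fun s => B ((v - w) s.toNNReal)) t := by
      rw [sub_eq_iff_eq_add', hΦ, hΦ, add_assoc,
        ← hS.conv_add (hBc w).continuousOn (hBc (v - w)).continuousOn t.coe_nonneg]
      simp
    have := hM.nonneg
    calc dist (Φ v t) (Φ w t) = ‖conv S (fun s => B ((v - w) s.toNNReal)) t‖ := by
          rw [dist_eq_norm, hdiff]
      _ ≤ M * (‖B‖ * ‖v - w‖) / μ := hM.norm_conv_le_of_norm_le hμ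
          (fun s _ => B.le_opNorm_of_le ((v - w).norm_coe_le_norm _)) t.2
      _ = M * ‖B‖ / μ * dist v w := by rw [dist_eq_norm]; ring
      _ ≤ 1 / 2 * dist v w := by gcongr
      _ = _ := by simp
  obtain ⟨v, hfix⟩ : ∃ v, Φ v = v := ⟨_, hcontr.fixedPoint_isFixedPt⟩
  refine ⟨fun t => v t.toNNReal, (v.continuous.comp continuous_real_toNNReal).continuousOn,
    fun t ht => ?_⟩
  have h := hΦ v t.toNNReal
  rwa [hfix, Real.coe_toNNReal t ht] at h

theorem IsC0Semigroup.exists_isMildSolution (hS : IsC0Semigroup S) (B : X →L[ℝ] X) (x : X) :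
    ∃ v, IsMildSolution S B x v := by
  obtain ⟨M, ω, -, hM⟩ := hS.exists_hasGrowthBound
  have hM0 := hM.nonneg
  set μ := 2 * (M * ‖B‖) + 1
  obtain ⟨v, hv⟩ := (hS.exp_smul (-(ω + μ))).exists_isMildSolution_of_stable (μ := μ) (B := B)
    (by simpa using hM.exp_smul (-(ω + μ))) (by positivity)
    (by rw [div_le_iff₀ (by positivity)]; grind) x
  have h := hv.exp_smul (ω + μ)
  simp only [smul_smul, ← Real.exp_add, neg_mul, add_neg_cancel, Real.exp_zero, one_smul] at h
  exact ⟨_, h⟩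

theorem IsC0Semigroup.exists_isMildSolution_semigroup (hS : IsC0Semigroup S) (B : X →L[ℝ] X) :
    ∃ V : ℝ → X →L[ℝ] X, IsC0Semigroup V ∧ ∀ x, IsMildSolution S B x (fun t => V t x) := by
  obtain ⟨M, ω, -, hM⟩ := hS.exists_hasGrowthBound
  choose v hv using hS.exists_isMildSolution B
  let V (t : ℝ) : X →L[ℝ] X := LinearMap.mkContinuous
    { toFun x := v x (max 0 t)
      map_add' x y := (hv (x + y)).eqOn ((hv x).add (hv y) hS) hS (le_max_left 0 t)
      map_smul' c x := (hv (c • x)).eqOn ((hv x).const_smul c) hS (le_max_left 0 t) }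
    _ fun x => (hv x).norm_le hM (le_max_left 0 t)
  have hV (t : ℝ) (ht : 0 ≤ t) (x : X) : V t x = v x t := by
    simp only [V, LinearMap.mkContinuous_apply, LinearMap.coe_mk, AddHom.coe_mk, max_eq_right ht]
  refine ⟨V, ⟨?_, ?_, ?_⟩, fun x => (hv x).congr fun t ht => hV t ht x⟩
  · ext x
    rw [hV 0 le_rfl, (hv x).apply_zero hS, ContinuousLinearMap.id_apply]
  · intro s t hs ht
    ext x
    rw [ContinuousLinearMap.comp_apply, hV _ (add_nonneg hs ht), hV t ht, hV s hs]
    exact ((hv x).comp_add_right hS ht).eqOn (hv _) hS hs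
  · exact fun x => (hv x).continuousOn.congr fun t ht => hV t ht x

end MildSolution

section Perturbation

variable {X : Type*} [NormedAddCommGroup X] [NormedSpace ℝ X] {A : X →ₗ.[ℝ] X}
  {S V : ℝ → X →L[ℝ] X} {M ω : ℝ}

theorem mem_graph_vadd_iff {R E F : Type*} [Ring R] [AddCommGroup E] [Module R E] [AddCommGroup F]
    [Module R F] {f : E →ₗ[R] F} {g : E →ₗ.[R] F} {x : E} {y : F} :
    (x, y) ∈ (f +ᵥ g).graph ↔ (x, y - f x) ∈ g.graph := by
  have hval (z : g.domain) : f z + g z = y ↔ g z = y - f z := eq_sub_iff_add_eq'.symm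
  simp only [LinearPMap.mem_graph_iff]
  constructor
  · rintro ⟨z, rfl, hz⟩
    exact ⟨z, rfl, (hval z).1 hz⟩
  · rintro ⟨z, rfl, hz⟩
    exact ⟨z, rfl, (hval z).2 hz⟩

variable [CompleteSpace X]

theorem IsGeneratorOf.hasDerivWithinAt_comp_orbit_zero (hAS : IsGeneratorOf A S)
    (hS : IsC0Semigroup S) (hAV : IsGeneratorOf A V) (hV : IsC0Semigroup V) {x y : X}
    (h : (x, y) ∈ A.graph) {s t : ℝ} (hs : 0 ≤ s) (hst : s < t) :
    HasDerivWithinAt (fun r => V (t - r) (S r x)) 0 (Ici s) s := by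
  have hquot : Tendsto (fun r : ℝ => r⁻¹ • (S (s + r) x - V r (S s x))) (𝓝[>] 0) (𝓝 0) := by
    have hz := ((hAS _ _).1 (hAS.map_mem_graph hS h hs)).sub
      ((hAV _ _).1 (hAS.map_mem_graph hS h hs))
    rw [sub_self] at hz
    refine hz.congr' ?_
    filter_upwards [self_mem_nhdsWithin] with r hr
    rw [← smul_sub, sub_sub_sub_cancel_right, add_comm s r,
      hS.map_add_apply (le_of_lt hr) hs]
  have hlt : ∀ᶠ r : ℝ in 𝓝[>] 0, r ≤ t - s :=
    nhdsWithin_le_nhds (eventually_le_nhds (sub_pos.2 hst))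
  have htime : Tendsto (fun r : ℝ => t - s - r) (𝓝[>] 0) (𝓝 (t - s)) := by
    have : Tendsto (fun r : ℝ => t - s - r) (𝓝 0) (𝓝 (t - s)) :=
      Continuous.tendsto' (by fun_prop) _ _ (sub_zero _)
    exact this.mono_left nhdsWithin_le_nhds
  have hlim := (hV.continuousOn_uncurry (t - s, 0) ⟨sub_nonneg.2 hst.le, mem_univ _⟩).tendsto.comp
    (tendsto_nhdsWithin_iff.2 ⟨htime.prodMk_nhds hquot,
      hlt.mono fun r hr => ⟨sub_nonneg.2 hr, mem_univ _⟩⟩)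
  rw [map_zero] at hlim
  rw [hasDerivWithinAt_Ici_iff_tendsto_inv_smul]
  refine hlim.congr' ?_
  filter_upwards [self_mem_nhdsWithin, hlt] with r hr hrt
  have hsplit : V (t - s) (S s x) = V (t - s - r) (V r (S s x)) := by
    rw [← hV.map_add_apply (sub_nonneg.2 hrt) (le_of_lt hr), sub_add_cancel]
  rw [hsplit, ← sub_sub, ← map_sub, ← map_smul]
  rfl

theorem IsGeneratorOf.eqOn (hAS : IsGeneratorOf A S) (hS : IsC0Semigroup S)
    (hAV : IsGeneratorOf A V) (hV : IsC0Semigroup V) : EqOn S V (Ici 0) := by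
  intro t ht
  have hdomain : EqOn (S t) (V t) A.domain := by
    intro x hx
    obtain ⟨y, hxy⟩ := LinearPMap.mem_domain_iff.1 hx
    have hcont : ContinuousOn (fun s => V (t - s) (S s x)) (Icc 0 t) :=
      hV.continuousOn_apply (by fun_prop) ((hS.continuousOn x).mono Icc_subset_Ici_self)
        fun s hs => sub_nonneg.2 hs.2
    have h := constant_of_has_deriv_right_zero hcont
      (fun s hs => hAS.hasDerivWithinAt_comp_orbit_zero hS hAV hV hxy hs.1 hs.2) t ⟨ht, le_rfl⟩
    simpa [hS.map_zero, hV.map_zero] using h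
  exact DFunLike.coe_injective
    ((S t).continuous.ext_on (hAS.dense_domain hS) (V t).continuous hdomain)

theorem IsGeneratorOf.vadd_of_isMildSolution (hA : IsGeneratorOf A S) (hS : IsC0Semigroup S)
    {B : X →L[ℝ] X} (hV : IsC0Semigroup V) (h : ∀ x, IsMildSolution S B x (fun t => V t x)) :
    IsGeneratorOf ((B : X →ₗ[ℝ] X) +ᵥ A) V := by
  suffices ∀ x y, (x, y) ∈ ((B : X →ₗ[ℝ] X) +ᵥ A).graph ↔
      HasDerivWithinAt (fun t => V t x) y (Ici 0) 0 by
    intro x y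
    simp [this, hasDerivWithinAt_Ici_iff_tendsto_inv_smul, hV.map_zero]
  intro x y
  have hconv := hS.hasDerivWithinAt_conv_zero (h x).continuousOn_perturbation
  rw [hV.map_zero, ContinuousLinearMap.id_apply] at hconv
  rw [mem_graph_vadd_iff, hA.mem_graph_iff_hasDerivWithinAt hS]
  constructor <;> intro hx
  · simpa using (hx.add hconv).congr_of_mem (fun t ht => (h x).eq_add_conv t ht) self_mem_Ici
  · refine (hx.sub hconv).congr_of_mem (fun t ht => ?_) self_mem_Ici
    exact eq_sub_of_add_eq ((h x).eq_add_conv t ht).symm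

theorem GeneratesC0Semigroup.vadd (hA : GeneratesC0Semigroup A) (B : X →L[ℝ] X) :
    GeneratesC0Semigroup ((B : X →ₗ[ℝ] X) +ᵥ A) := by
  obtain ⟨S, hS, hAS⟩ := hA
  obtain ⟨V, hV, hmild⟩ := hS.exists_isMildSolution_semigroup B
  exact ⟨V, hV, hAS.vadd_of_isMildSolution hS hV hmild⟩

theorem HasGrowthBound.vadd (hM : HasGrowthBound S M ω) (hA : IsGeneratorOf A S)
    (hS : IsC0Semigroup S) {B : X →L[ℝ] X} (hBA : IsGeneratorOf ((B : X →ₗ[ℝ] X) +ᵥ A) V)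
    (hV : IsC0Semigroup V) : HasGrowthBound V M (ω + M * ‖B‖) := by
  obtain ⟨W, hW, hmild⟩ := hS.exists_isMildSolution_semigroup B
  intro t ht
  rw [hBA.eqOn hV (hA.vadd_of_isMildSolution hS hW hmild) hW ht]
  have hM0 := hM.nonneg
  exact ContinuousLinearMap.opNorm_le_bound _ (by positivity) fun x => (hmild x).norm_le hM ht

end Perturbation

section Phi

variable {X : Type*} [NormedAddCommGroup X] [NormedSpace ℝ X] {A : X →ₗ.[ℝ] X}

theorem GeneratesC0Semigroup.isC0Semigroup_expSemigroup (hA : GeneratesC0Semigroup A) :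
    IsC0Semigroup (expSemigroup A) := by
  rw [expSemigroup, dif_pos hA]
  exact hA.choose_spec.1

theorem GeneratesC0Semigroup.isGeneratorOf_expSemigroup (hA : GeneratesC0Semigroup A) :
    IsGeneratorOf A (expSemigroup A) := by
  rw [expSemigroup, dif_pos hA]
  exact hA.choose_spec.2

/-- The Taylor-type approximation of `φ_k(τA) x₁` along a chain with `A x₁ = x₂` and
`A x₂ = x₃ - g`. -/
noncomputable def phiExpansion (k : ℕ) (τ : ℝ) (A : X →ₗ.[ℝ] X) (x₁ x₂ x₃ g : X) : X :=
  (1 / (k.factorial : ℝ)) • x₁ + (τ / ((k + 1).factorial : ℝ)) • x₂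
    + τ ^ 2 • ((1 / ((k + 2).factorial : ℝ)) • x₃ - phi (k + 2) τ A g)

theorem phiExpansion_mul (k : ℕ) (t h : ℝ) (x₁ x₂ x₃ g : X) :
    phiExpansion k (t * h) A x₁ x₂ x₃ g =
      (1 / (k.factorial : ℝ)) • x₁ + (h * (t / ((k + 1).factorial : ℝ))) • x₂
        + (t ^ 2 * h ^ 2 * (1 / ((k + 2).factorial : ℝ))) •
          (x₃ - ((k + 2).factorial : ℝ) • phi (k + 2) (t * h) A g) := by
  rw [phiExpansion]
  match_scalars <;> field_simp

theorem sum_smul_phiExpansion (s : ℕ) (p : ℕ → ℝ) (τ : ℝ) (x₁ x₂ x₃ g : X) :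
    ∑ k ∈ Finset.Icc 1 s, p k • phiExpansion k τ A x₁ x₂ x₃ g =
      bigP1 s p • x₁ + (τ * bigP2 s p) • x₂
        + τ ^ 2 • (bigP3 s p • x₃ - ∑ k ∈ Finset.Icc 1 s, p k • phi (k + 2) τ A g) := by
  simp only [bigP1, bigP2, bigP3, Finset.mul_sum, Finset.sum_smul, Finset.smul_sum,
    ← Finset.sum_sub_distrib, ← Finset.sum_add_distrib]
  refine Finset.sum_congr rfl fun k _ => ?_
  rw [phiExpansion]
  module

theorem hasDerivAt_pow_div_factorial (n : ℕ) (θ : ℝ) :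
    HasDerivAt (fun θ : ℝ => θ ^ (n + 1) / ((n + 1).factorial : ℝ)) (θ ^ n / (n.factorial : ℝ))
      θ := by
  refine ((hasDerivAt_pow (n + 1) θ).div_const _).congr_deriv ?_
  rw [Nat.factorial_succ, Nat.add_sub_cancel, Nat.cast_mul, mul_div_mul_left _ _ (by positivity)]

theorem norm_phi_le {M ω τ : ℝ} (hM : HasGrowthBound (expSemigroup A) M ω) (hω : 0 ≤ ω)
    (hτ : 0 ≤ τ) (k : ℕ) (x : X) : ‖phi k τ A x‖ ≤ M * Real.exp (ω * τ) * ‖x‖ := by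
  have hM0 := hM.nonneg
  have hintegrand (θ : ℝ) (hθ : θ ∈ uIoc (0 : ℝ) 1) :
      ‖(θ ^ (k - 1) / ((k - 1).factorial : ℝ)) • expSemigroup A ((1 - θ) * τ) x‖ ≤
        M * Real.exp (ω * τ) * ‖x‖ := by
    rw [uIoc_of_le zero_le_one] at hθ
    have hθ0 := hθ.1.le
    have hweight : θ ^ (k - 1) / ((k - 1).factorial : ℝ) ≤ 1 :=
      div_le_one_of_le₀ ((pow_le_one₀ hθ0 hθ.2).trans
        (Nat.one_le_cast.2 (Nat.factorial_pos _))) (by positivity)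
    have htime : (1 - θ) * τ ≤ τ := mul_le_of_le_one_left hτ (by linarith)
    rw [norm_smul, Real.norm_of_nonneg (by positivity)]
    calc _ ≤ 1 * (M * Real.exp (ω * ((1 - θ) * τ)) * ‖x‖) := by
          gcongr
          exact hM.norm_apply_le (mul_nonneg (sub_nonneg.2 hθ.2) hτ) x
      _ ≤ M * Real.exp (ω * τ) * ‖x‖ := by
          rw [one_mul]
          gcongr
  simpa [phi] using intervalIntegral.norm_integral_le_of_norm_le_const hintegrand

theorem IsC0Semigroup.continuousOn_reversed_orbit {S : ℝ → X →L[ℝ] X} (hS : IsC0Semigroup S)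
    {τ : ℝ} (hτ : 0 ≤ τ) (x : X) :
    ContinuousOn (fun θ => S ((1 - θ) * τ) x) (uIcc 0 1) := by
  rw [uIcc_of_le zero_le_one]
  exact (hS.continuousOn x).comp (by fun_prop) fun θ hθ => mul_nonneg (sub_nonneg.2 hθ.2) hτ

theorem GeneratesC0Semigroup.phi_sub (hA : GeneratesC0Semigroup A) (k : ℕ) {τ : ℝ} (hτ : 0 ≤ τ)
    (x y : X) :
    phi k τ A (x - y) = phi k τ A x - phi k τ A y := by
  have hint (x : X) : IntervalIntegrable (fun θ : ℝ =>
      (θ ^ (k - 1) / ((k - 1).factorial : ℝ)) • expSemigroup A ((1 - θ) * τ) x) volume 0 1 :=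
    (ContinuousOn.smul (by fun_prop)
      (hA.isC0Semigroup_expSemigroup.continuousOn_reversed_orbit hτ x)).intervalIntegrable
  simp only [phi, ← intervalIntegral.integral_sub (hint x) (hint y), map_sub, smul_sub]

variable [CompleteSpace X]

theorem IsGeneratorOf.hasDerivWithinAt_reversed_orbit {S : ℝ → X →L[ℝ] X}
    (hA : IsGeneratorOf A S) (hS : IsC0Semigroup S) {x y : X} (h : (x, y) ∈ A.graph)
    {τ : ℝ} (hτ : 0 ≤ τ) {θ : ℝ} (hθ : θ ∈ uIcc (0 : ℝ) 1) :
    HasDerivWithinAt (fun θ => S ((1 - θ) * τ) x) (-τ • S ((1 - θ) * τ) y) (uIcc 0 1) θ := by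
  rw [uIcc_of_le zero_le_one] at hθ ⊢
  have htime : HasDerivWithinAt (fun θ : ℝ => (1 - θ) * τ) (-τ) (Icc 0 1) θ := by
    simpa using (((hasDerivAt_id θ).const_sub 1).mul_const τ).hasDerivWithinAt
  have hmaps : MapsTo (fun θ : ℝ => (1 - θ) * τ) (Icc 0 1) (Ici 0) :=
    fun θ hθ => mul_nonneg (sub_nonneg.2 hθ.2) hτ
  exact (hA.hasDerivWithinAt_orbit hS h (hmaps hθ)).scomp θ htime hmaps

namespace GeneratesC0Semigroup

/-- Integration by parts in the integral defining `φ_{k+1}`; formally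
`φ_k(z) = 1/k! + z φ_{k+1}(z)`. -/
theorem phi_eq (hA : GeneratesC0Semigroup A) {x y : X} (hxy : (x, y) ∈ A.graph) {k : ℕ}
    (hk : 1 ≤ k) {τ : ℝ} (hτ : 0 ≤ τ) :
    phi k τ A x = (1 / (k.factorial : ℝ)) • x + τ • phi (k + 1) τ A y := by
  obtain ⟨n, rfl⟩ := Nat.exists_eq_add_of_le' hk
  have hS := hA.isC0Semigroup_expSemigroup
  have hparts := intervalIntegral.integral_smul_deriv_eq_deriv_smul_of_hasDerivWithinAt
    (fun θ _ => (hasDerivAt_pow_div_factorial n θ).hasDerivWithinAt)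
    (fun θ hθ => hA.isGeneratorOf_expSemigroup.hasDerivWithinAt_reversed_orbit hS hxy hτ hθ)
    (Continuous.intervalIntegrable (by fun_prop) _ _)
    ((hS.continuousOn_reversed_orbit hτ y).const_smul (-τ)).intervalIntegrable
  simp only [smul_comm _ (-τ), intervalIntegral.integral_smul] at hparts
  have hboundary : -τ • phi (n + 2) τ A y =
      (1 / ((n + 1).factorial : ℝ)) • x - phi (n + 1) τ A x := by
    simpa [phi, hS.map_zero] using hparts
  rw [← sub_neg_eq_add, ← neg_smul, hboundary, sub_sub_cancel]

theorem phi_eq_phiExpansion_add (hA : GeneratesC0Semigroup A) {x₁ x₂ x₃ g z : X}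
    (h₁ : (x₁, x₂) ∈ A.graph) (h₂ : (x₂, x₃ - g) ∈ A.graph) (h₃ : (x₃, z) ∈ A.graph) {k : ℕ}
    (hk : 1 ≤ k) {τ : ℝ} (hτ : 0 ≤ τ) :
    phi k τ A x₁ = phiExpansion k τ A x₁ x₂ x₃ g + τ ^ 3 • phi (k + 3) τ A z := by
  rw [phiExpansion, hA.phi_eq h₁ hk hτ, hA.phi_eq h₂ (by lia) hτ, hA.phi_sub _ hτ,
    hA.phi_eq h₃ (by lia) hτ]
  module

end GeneratesC0Semigroup

end Phi

section Trajectory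

variable {X : Type*} [NormedAddCommGroup X] [NormedSpace ℝ X] {L : X →ₗ.[ℝ] X} {N : X → X}
  {t₀ T : ℝ} {u₀ : X} {u : ℝ → X} {t : ℝ}

theorem GeneratesC0Semigroup.jacobian [CompleteSpace X] (hL : GeneratesC0Semigroup L)
    (N : X → X) (w : X) : GeneratesC0Semigroup (jacobian L N w) :=
  hL.vadd (fderiv ℝ N w)

theorem contDiffAt_remNonlin {n : WithTop ℕ∞} {v : X} (hN : ContDiffAt ℝ n N v) (w : X) :
    ContDiffAt ℝ n (remNonlin N w) v :=
  hN.sub (fderiv ℝ N w).contDiff.contDiffAt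

theorem fderiv_remNonlin_self {w : X} (hN : DifferentiableAt ℝ N w) :
    fderiv ℝ (remNonlin N w) w = 0 := by
  have h := hN.hasFDerivAt.sub (fderiv ℝ N w).hasFDerivAt
  rw [sub_self] at h
  exact h.fderiv

namespace SmoothSolution

theorem uniqueDiffOn (hu : SmoothSolution L N t₀ T u₀ u) : UniqueDiffOn ℝ (Icc t₀ T) :=
  uniqueDiffOn_Icc hu.lt

theorem contDiffAt_nonlin (hu : SmoothSolution L N t₀ T u₀ u) (ht : t ∈ Icc t₀ T) :
    ContDiffAt ℝ 3 N (u t) := by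
  obtain ⟨δ, hδ, hN⟩ := hu.nonlin
  exact hN.contDiffAt (Metric.isOpen_thickening.mem_nhds
    (Metric.self_subset_thickening hδ _ (mem_image_of_mem u ht)))

theorem contDiffOn_three (hu : SmoothSolution L N t₀ T u₀ u) : ContDiffOn ℝ 3 u (Icc t₀ T) :=
  hu.contDiffOn.of_le (by norm_num)

theorem contDiffOn_comp (hu : SmoothSolution L N t₀ T u₀ u) :
    ContDiffOn ℝ 3 (N ∘ u) (Icc t₀ T) := fun t ht =>
  (hu.contDiffAt_nonlin ht).comp_contDiffWithinAt t (hu.contDiffOn_three t ht)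

theorem contDiffOn_remNonlin_comp (hu : SmoothSolution L N t₀ T u₀ u) (w : X) :
    ContDiffOn ℝ 3 (remNonlin N w ∘ u) (Icc t₀ T) := fun t ht =>
  (contDiffAt_remNonlin (hu.contDiffAt_nonlin ht) w).comp_contDiffWithinAt t
    (hu.contDiffOn_three t ht)

theorem continuousOn_iteratedDerivWithin (hu : SmoothSolution L N t₀ T u₀ u) {n : ℕ}
    (hn : n ≤ 4) : ContinuousOn (iteratedDerivWithin n u (Icc t₀ T)) (Icc t₀ T) :=
  hu.contDiffOn.continuousOn_iteratedDerivWithin (by exact_mod_cast hn) hu.uniqueDiffOn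

theorem continuousOn_fderiv_nonlin (hu : SmoothSolution L N t₀ T u₀ u) :
    ContinuousOn (fun t => fderiv ℝ N (u t)) (Icc t₀ T) := fun t ht =>
  ((hu.contDiffAt_nonlin ht).continuousAt_fderiv (by norm_num)).comp_continuousWithinAt
    (hu.contDiffOn.continuousOn t ht)

theorem iteratedDerivWithin_one_eq_rhs (hu : SmoothSolution L N t₀ T u₀ u)
    (ht : t ∈ Icc t₀ T) :
    iteratedDerivWithin 1 u (Icc t₀ T) t = rhs L N ⟨u t, hu.mem_domain t ht⟩ := by
  rw [iteratedDerivWithin_one]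
  exact (hu.hasDeriv t ht).derivWithin (hu.uniqueDiffOn t ht)

theorem mem_graph_jacobian (hu : SmoothSolution L N t₀ T u₀ u) (w : X) (ht : t ∈ Icc t₀ T) :
    (u t, iteratedDerivWithin 1 u (Icc t₀ T) t - remNonlin N w (u t)) ∈
      (jacobian L N w).graph := by
  rw [hu.iteratedDerivWithin_one_eq_rhs ht, remNonlin_eq L N w ⟨u t, hu.mem_domain t ht⟩,
    sub_sub_cancel]
  exact (jacobian L N w).mem_graph ⟨u t, hu.mem_domain t ht⟩

/-- Since `J` is closed, the equation `u' = J u + Ñ(u)` can be differentiated. -/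
theorem iteratedDerivWithin_mem_graph_jacobian [CompleteSpace X]
    (hu : SmoothSolution L N t₀ T u₀ u) (hL : GeneratesC0Semigroup L) (w : X) {n : ℕ}
    (hn : n ≤ 3) (ht : t ∈ Icc t₀ T) :
    (iteratedDerivWithin n u (Icc t₀ T) t,
      iteratedDerivWithin (n + 1) u (Icc t₀ T) t
        - iteratedDerivWithin n (remNonlin N w ∘ u) (Icc t₀ T) t) ∈
      (jacobian L N w).graph := by
  have hn' : (n : WithTop ℕ∞) ≤ 3 := by exact_mod_cast hn
  have hderiv : ContDiffWithinAt ℝ n (derivWithin u (Icc t₀ T)) (Icc t₀ T) t :=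
    (hu.contDiffOn.derivWithin (m := 3) hu.uniqueDiffOn (by norm_num) t ht).of_le hn'
  have hrem := (hu.contDiffOn_remNonlin_comp w t ht).of_le hn'
  rw [iteratedDerivWithin_succ', ← iteratedDerivWithin_sub ht hu.uniqueDiffOn hderiv hrem]
  refine iteratedDerivWithin_mem_graph (hL.jacobian N w).isClosed_graph
    ((hu.contDiffOn_three t ht).of_le hn') (hderiv.sub hrem) hu.uniqueDiffOn ht fun r hr => ?_
  rw [Pi.sub_apply, ← iteratedDerivWithin_one]
  exact hu.mem_graph_jacobian w hr

theorem iteratedDerivWithin_one_remNonlin_comp (hu : SmoothSolution L N t₀ T u₀ u)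
    (ht : t ∈ Icc t₀ T) :
    iteratedDerivWithin 1 (remNonlin N (u t) ∘ u) (Icc t₀ T) t = 0 := by
  have hN := (hu.contDiffAt_nonlin ht).differentiableAt (by norm_num)
  have hrem := (contDiffAt_remNonlin (hu.contDiffAt_nonlin ht) (u t)).differentiableAt
    (by norm_num)
  have h := hrem.hasFDerivAt.comp_hasDerivWithinAt t (hu.hasDeriv t ht)
  rw [iteratedDerivWithin_one, h.derivWithin (hu.uniqueDiffOn t ht), fderiv_remNonlin_self hN]
  rfl

theorem iteratedDerivWithin_two_remNonlin_comp (hu : SmoothSolution L N t₀ T u₀ u)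
    (ht : t ∈ Icc t₀ T) :
    iteratedDerivWithin 2 (remNonlin N (u t) ∘ u) (Icc t₀ T) t = secondTerm N t₀ T u t := by
  have hN := hu.contDiffAt_nonlin ht
  have hrem : ContDiffAt ℝ 2 (remNonlin N (u t)) (u t) :=
    contDiffAt_remNonlin (hN.of_le (by norm_num)) _
  rw [iteratedDerivWithin_vcomp_two (t := univ) hrem
    ((hu.contDiffOn_three t ht).of_le (by norm_num)) uniqueDiffOn_univ hu.uniqueDiffOn ht
    (mapsTo_univ _ _), fderivWithin_univ, fderiv_remNonlin_self (hN.differentiableAt (by norm_num)),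
    iteratedFDerivWithin_univ, secondTerm, iteratedDerivWithin_one]
  exact add_zero _

theorem iteratedDerivWithin_three_remNonlin_comp (hu : SmoothSolution L N t₀ T u₀ u) (w : X)
    (ht : t ∈ Icc t₀ T) :
    iteratedDerivWithin 3 (remNonlin N w ∘ u) (Icc t₀ T) t =
      iteratedDerivWithin 3 (N ∘ u) (Icc t₀ T) t
        - fderiv ℝ N w (iteratedDerivWithin 3 u (Icc t₀ T) t) := by
  have hlin : iteratedDerivWithin 3 (fderiv ℝ N w ∘ u) (Icc t₀ T) t =
      fderiv ℝ N w (iteratedDerivWithin 3 u (Icc t₀ T) t) := by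
    simp only [iteratedDerivWithin, (fderiv ℝ N w).iteratedFDerivWithin_comp_left
      (hu.contDiffOn_three t ht) hu.uniqueDiffOn ht (i := 3) le_rfl]
    rfl
  rw [← hlin]
  exact iteratedDerivWithin_sub ht hu.uniqueDiffOn (hu.contDiffOn_comp t ht)
    ((fderiv ℝ N w).contDiff.comp_contDiffWithinAt (hu.contDiffOn_three t ht))

theorem exists_norm_jacobian_third_le (hu : SmoothSolution L N t₀ T u₀ u) :
    ∃ D, ∀ t ∈ Icc t₀ T, ‖iteratedDerivWithin 4 u (Icc t₀ T) t
      - iteratedDerivWithin 3 (remNonlin N (u t) ∘ u) (Icc t₀ T) t‖ ≤ D := by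
  have hcont : ContinuousOn (fun t => iteratedDerivWithin 4 u (Icc t₀ T) t
      - iteratedDerivWithin 3 (remNonlin N (u t) ∘ u) (Icc t₀ T) t) (Icc t₀ T) := by
    refine ((hu.continuousOn_iteratedDerivWithin le_rfl).sub
      ((hu.contDiffOn_comp.continuousOn_iteratedDerivWithin le_rfl hu.uniqueDiffOn).sub
        (hu.continuousOn_fderiv_nonlin.clm_apply
          (hu.continuousOn_iteratedDerivWithin (n := 3) (by norm_num))))).congr fun t ht => ?_
    rw [hu.iteratedDerivWithin_three_remNonlin_comp _ ht]
    rfl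
  exact isCompact_Icc.exists_bound_of_continuousOn hcont

variable [CompleteSpace X]

theorem exists_hasGrowthBound_jacobian (hu : SmoothSolution L N t₀ T u₀ u)
    (hL : GeneratesC0Semigroup L) :
    ∃ M ω, 0 ≤ ω ∧ ∀ t ∈ Icc t₀ T,
      HasGrowthBound (expSemigroup (jacobian L N (u t))) M ω := by
  have hS := hL.isC0Semigroup_expSemigroup
  obtain ⟨M, ω, hω, hM⟩ := hS.exists_hasGrowthBound
  obtain ⟨β, hβ⟩ := isCompact_Icc.exists_bound_of_continuousOn hu.continuousOn_fderiv_nonlin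
  have hM0 := hM.nonneg
  have hβ0 : 0 ≤ β := (norm_nonneg _).trans (hβ t₀ (left_mem_Icc.2 hu.lt.le))
  refine ⟨M, ω + M * β, by positivity, fun t ht => ?_⟩
  have hJ := hL.jacobian N (u t)
  refine (hM.vadd hL.isGeneratorOf_expSemigroup hS hJ.isGeneratorOf_expSemigroup
    hJ.isC0Semigroup_expSemigroup).mono_right ?_
  gcongr
  exact hβ t ht

theorem exists_norm_phi_sub_phiExpansion_le (hu : SmoothSolution L N t₀ T u₀ u)
    (hL : GeneratesC0Semigroup L) (H : ℝ) :
    ∃ C, ∀ k, 1 ≤ k → ∀ t (ht : t ∈ Icc t₀ T), ∀ τ, 0 ≤ τ → τ ≤ H →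
      ‖phi k τ (jacobian L N (u t)) (rhs L N ⟨u t, hu.mem_domain t ht⟩)
          - phiExpansion k τ (jacobian L N (u t)) (iteratedDerivWithin 1 u (Icc t₀ T) t)
              (iteratedDerivWithin 2 u (Icc t₀ T) t) (iteratedDerivWithin 3 u (Icc t₀ T) t)
              (secondTerm N t₀ T u t)‖ ≤ C * τ ^ 3 := by
  obtain ⟨M, ω, hω, hM⟩ := hu.exists_hasGrowthBound_jacobian hL
  obtain ⟨D, hD⟩ := hu.exists_norm_jacobian_third_le
  refine ⟨M * Real.exp (ω * H) * D, fun k hk t ht τ hτ hτH => ?_⟩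
  have hM0 := (hM t ht).nonneg
  have h₁ := hu.iteratedDerivWithin_mem_graph_jacobian hL (u t) (n := 1) (by norm_num) ht
  have h₂ := hu.iteratedDerivWithin_mem_graph_jacobian hL (u t) (n := 2) (by norm_num) ht
  have h₃ := hu.iteratedDerivWithin_mem_graph_jacobian hL (u t) (n := 3) le_rfl ht
  rw [hu.iteratedDerivWithin_one_remNonlin_comp ht, sub_zero] at h₁
  rw [hu.iteratedDerivWithin_two_remNonlin_comp ht] at h₂
  have hJ := hL.jacobian N (u t)
  rw [← hu.iteratedDerivWithin_one_eq_rhs ht, hJ.phi_eq_phiExpansion_add h₁ h₂ h₃ hk hτ,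
    add_sub_cancel_left, norm_smul, Real.norm_of_nonneg (by positivity), mul_comm]
  gcongr
  calc _ ≤ M * Real.exp (ω * τ) * _ := norm_phi_le (hM t ht) hω hτ _ _
    _ ≤ M * Real.exp (ω * H) * D := by
        gcongr
        exact hD t ht

theorem exists_norm_psi_sub_sum_phiExpansion_le (hu : SmoothSolution L N t₀ T u₀ u)
    (hL : GeneratesC0Semigroup L) (s : ℕ) (p : ℕ → ℝ) (H : ℝ) :
    ∃ C, ∀ t (ht : t ∈ Icc t₀ T), ∀ τ, 0 ≤ τ → τ ≤ H →
      ‖psi s p τ (jacobian L N (u t)) (rhs L N ⟨u t, hu.mem_domain t ht⟩)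
          - ∑ k ∈ Finset.Icc 1 s, p k • phiExpansion k τ (jacobian L N (u t))
              (iteratedDerivWithin 1 u (Icc t₀ T) t) (iteratedDerivWithin 2 u (Icc t₀ T) t)
              (iteratedDerivWithin 3 u (Icc t₀ T) t) (secondTerm N t₀ T u t)‖
        ≤ C * τ ^ 3 := by
  obtain ⟨C, hC⟩ := hu.exists_norm_phi_sub_phiExpansion_le hL H
  refine ⟨∑ k ∈ Finset.Icc 1 s, |p k| * C, fun t ht τ hτ hτH => ?_⟩
  rw [psi, ← Finset.sum_sub_distrib, Finset.sum_mul]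
  refine norm_sum_le_of_le _ fun k hk => ?_
  rw [← smul_sub, norm_smul, Real.norm_eq_abs, mul_assoc]
  gcongr
  exact hC k (Finset.mem_Icc.1 hk).1 t ht τ hτ hτH

end SmoothSolution

end Trajectory

end EPIRK

theorem mainTheorem4 {X : Type*} [NormedAddCommGroup X] [NormedSpace ℝ X] [CompleteSpace X]
    (L : X →ₗ.[ℝ] X) (N : X → X) (t₀ T : ℝ) (u₀ : X) (u : ℝ → X)
    (hL : EPIRK.GeneratesC0Semigroup L)
    (hu : EPIRK.SmoothSolution L N t₀ T u₀ u) :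
    (∀ tn ∈ Set.Icc t₀ T, EPIRK.GeneratesC0Semigroup (EPIRK.jacobian L N (u tn))) ∧
    (∀ k : ℕ, 1 ≤ k → ∀ H : ℝ, ∃ C : ℝ,
      ∀ tn (htn : tn ∈ Set.Icc t₀ T), ∀ t h : ℝ, 0 ≤ t → 0 ≤ h → t * h ≤ H →
        ‖EPIRK.phi k (t * h) (EPIRK.jacobian L N (u tn))
              (EPIRK.rhs L N ⟨u tn, hu.mem_domain tn htn⟩)
            - ((1 / (k.factorial : ℝ)) • iteratedDerivWithin 1 u (Set.Icc t₀ T) tn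
              + (h * (t / ((k + 1).factorial : ℝ))) •
                  iteratedDerivWithin 2 u (Set.Icc t₀ T) tn
              + (t ^ 2 * h ^ 2 * (1 / ((k + 2).factorial : ℝ))) •
                  (iteratedDerivWithin 3 u (Set.Icc t₀ T) tn
                    - ((k + 2).factorial : ℝ) •
                        EPIRK.phi (k + 2) (t * h) (EPIRK.jacobian L N (u tn))
                          (EPIRK.secondTerm N t₀ T u tn)))‖
          ≤ C * (t ^ 3 * h ^ 3)) ∧
    (∀ (s : ℕ) (p : ℕ → ℝ) (H : ℝ), ∃ C : ℝ,
      ∀ tn (htn : tn ∈ Set.Icc t₀ T), ∀ t : ℝ, 0 ≤ t → t ≤ H →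
        ‖EPIRK.psi s p t (EPIRK.jacobian L N (u tn))
              (EPIRK.rhs L N ⟨u tn, hu.mem_domain tn htn⟩)
            - (EPIRK.bigP1 s p • iteratedDerivWithin 1 u (Set.Icc t₀ T) tn
              + (t * EPIRK.bigP2 s p) • iteratedDerivWithin 2 u (Set.Icc t₀ T) tn
              + t ^ 2 • (EPIRK.bigP3 s p • iteratedDerivWithin 3 u (Set.Icc t₀ T) tn
                  - ∑ k ∈ Finset.Icc 1 s, p k •
                      EPIRK.phi (k + 2) t (EPIRK.jacobian L N (u tn))
                        (EPIRK.secondTerm N t₀ T u tn)))‖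
          ≤ C * t ^ 3) := by
  refine ⟨fun tn _ => hL.jacobian N (u tn), fun k hk H => ?_, fun s p H => ?_⟩
  · obtain ⟨C, hC⟩ := hu.exists_norm_phi_sub_phiExpansion_le hL H
    refine ⟨C, fun tn htn t h ht hh hth => ?_⟩
    rw [← EPIRK.phiExpansion_mul, ← mul_pow]
    exact hC k hk tn htn (t * h) (by positivity) hth
  · obtain ⟨C, hC⟩ := hu.exists_norm_psi_sub_sum_phiExpansion_le hL s p H
    refine ⟨C, fun tn htn t ht htH => ?_⟩
    rw [← EPIRK.sum_smul_phiExpansion]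
    exact hC tn htn t ht htH
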